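/- Let $G$ be a finite simple graph with vertex set $\mathcal V$ and edge set $H\neq\emptyset$. A challenge is a pair $(e,b)$ with $e=\{i,j\}\in H$, $b\in\{0,1\}$; an answer to it consists of one label in $\mathbb F_3$ for each endpoint of $e$. **Challenge distribution $\mathcal D_G$.** $(e,b)$ is uniform in $H\times\{0,1\}$. With probability $\tfrac13$ put $(e',b')=(e,1-b)$; with probability $\tfrac23$ choose an endpoint $v$ of $e$ uniformly, then an edge $e'$ containing $v$ uniformly, and put $b'=b$. **Two-prover protocol.** The verifier draws $((e,b),(e',b'))\sim\mathcal D_G$, sends one challenge to each of two provers, and receives labels $a$ and $a'$. If $e=e'=\{i,j\}$ and $b\ne b'$, it accepts iff $a_i+a'_i\ne a_j+a'_j$. If $b=b'$, it accepts iff $a_v=a'_v$ for every common endpoint $v$ of $e,e'$. **Three-prover protocol.** The first two challenges are drawn from $\mathcal D_G$; the third is a copy of the first or of the second, with probability $\tfrac12$ each. The verifier accepts iff the two-prover check holds for the first two provers and the third prover gives the same answer as prover $1$ (resp. $2$) whenever it received the same challenge as prover $1$ (resp. $2$). Honest provers hold a proper 3-colouring $c$, share a uniformly random permutation $\pi$ of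 $\mathbb F_3$ and uniformly random labels $l^0_i$, set $l_i^1=\pi(c_i)-l_i^0$, and answer $(\{i,j\},b)$ by $l_i^b,l_j^b$. Malicious provers share an arbitrary state on finite-dimensional registers. On a challenge each applies a unitary, depending on the challenge, to its own register and measures an answer part of the register. Rewinding means applying the inverse unitary after the answer has been measured. **Knowledge error.** A protocol has knowledge error $\kappa=\kappa(G)$ on a class $\mathcal G$ of graphs with the polynomial-time extractor $K$ if there are a constant $d>0$ and a positive, polynomially bounded function $p$ such that for every security parameter $\eta$, every polynomial $l$, every $G\in\mathcal G$ of length at most $l(\eta)$ and every (malicious) strategy of the provers with acceptance probability $p_{\rm acc}>\kappa(G)$, the extractor outputs a proper 3-colouring of $G$ with probability at least $\frac1{p(\eta)}(p_{\rm acc}-\kappa(G))^d$. For the two-prover protocol the provers are classical with shared randomness, which is fixed under rewinding; thus the extractor is a probabilistic polynomial-time machine that is given $G$ and the answers of both provers to all challenges. **Theorem.** Let $\mathcal G$ be any class of such graphs and let $\tilde K$ be an extractor for the two-prover protocol against classical provers with knowledge error $\kappa_c=1-\frac1{3|H|}$ on $\mathcal G$. Let $K$ be the following extractor for the three-prover protocol: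 ask prover $1$ all $2|H|$ challenges one after the other, recording the measured answer and rewinding the prover each time; do the same with prover $2$; then run $\tilde K$ on the two recorded tables of answers. Then, for every $\tilde\delta=\tilde\delta(G)$ with $$\tilde\delta\ \ge\ \frac1{3|H|}-\Big(\frac1{7|H|}\Big)^4\qquad(G\in\mathcal G),$$ the three-prover protocol is on $\mathcal G$ a quantum proof of knowledge with the extractor $K$ and with knowledge error $\kappa_q=\kappa_c+\tilde\delta$. That is: the verifier accepts honest provers with probability $1$, $K$ makes polynomially many oracle calls followed by polynomial-time classical computation, and $K$ has knowledge error $\kappa_q$ on $\mathcal G$ against all entangled provers. -/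

import Mathlib

open scoped Kronecker ComplexOrder

noncomputable section

namespace ThreeCol

/-! ### Graphs, colourings, challenges and answers -/

/-- A finite simple graph with vertex set `Fin n` and edge set `H`, listed in some order as
`end1 k, end2 k` for `k : Fin m`, so that `m = |H|`. There is at least one edge. -/
structure GraphInstance where
  n : ℕ
  m : ℕ
  end1 : Fin m → Fin n
  end2 : Fin m → Fin n
  lt : ∀ k, end1 k < end2 k
  inj : Function.Injective fun k => (end1 k, end2 k)
  pos : 0 < m

namespace GraphInstance

/-- The witness relation: `c` is a proper 3-colouring of `G`. -/
def IsColoring (G : GraphInstance) (c : Fin G.n → ZMod 3) : Prop :=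
  ∀ k, c (G.end1 k) ≠ c (G.end2 k)

/-- The vertex `v` is an endpoint of the edge number `k`. -/
def Incident (G : GraphInstance) (v : Fin G.n) (k : Fin G.m) : Prop :=
  v = G.end1 k ∨ v = G.end2 k

instance (G : GraphInstance) (v : Fin G.n) (k : Fin G.m) : Decidable (G.Incident v k) :=
  inferInstanceAs (Decidable (_ ∨ _))

/-- `|Edges(v)|`, the number of edges at `v`. -/
def deg (G : GraphInstance) (v : Fin G.n) : ℕ :=
  (Finset.univ.filter fun k => G.Incident v k).card

end GraphInstance

/-- A challenge is an edge together with a bit. -/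
abbrev Question (G : GraphInstance) : Type := Fin G.m × Bool

/-- An answer consists of one element of `𝔽₃` for each endpoint of the edge asked. -/
abbrev Answer : Type := ZMod 3 × ZMod 3

/-- The label which the answer `a` to the edge `k` gives to the endpoint `v` of `k`. -/
def labelAt (G : GraphInstance) (k : Fin G.m) (a : Answer) (v : Fin G.n) : ZMod 3 :=
  if v = G.end1 k then a.1 else a.2

/-! ### The two-prover protocol -/

/-- The probability `ε` of the edge-verification test. -/
def evtProb : ℝ := 1 / 3

/-- The distribution `D_G` of the two challenges. The first challenge `(e, b)` is uniform. With
probability `ε` the second one is `(e, 1 - b)`; otherwise an endpoint `v` of `e` is chosen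
uniformly, then an edge `e'` at `v` uniformly, and the second challenge is `(e', b)`. -/
def challengeProb (G : GraphInstance) (q q' : Question G) : ℝ :=
  (if q'.1 = q.1 ∧ q'.2 ≠ q.2 then evtProb / (2 * G.m) else 0) +
  (if q'.2 = q.2 then
    (1 - evtProb) / (4 * G.m) *
      ((if G.Incident (G.end1 q.1) q'.1 then 1 / (G.deg (G.end1 q.1) : ℝ) else 0) +
       (if G.Incident (G.end2 q.1) q'.1 then 1 / (G.deg (G.end2 q.1) : ℝ) else 0))
  else 0)

/-- The check of the two-prover protocol: the edge-verification test when the same edge is asked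
with different bits, and the well-definition test at all common endpoints when the bits agree. -/
def Accepts2 (G : GraphInstance) (q q' : Question G) (a a' : Answer) : Prop :=
  (q.1 = q'.1 ∧ q.2 ≠ q'.2 → a.1 + a'.1 ≠ a.2 + a'.2) ∧
  (q.2 = q'.2 → ∀ v, G.Incident v q.1 → G.Incident v q'.1 →
    labelAt G q.1 a v = labelAt G q'.1 a' v)

/-- A deterministic strategy of one classical prover. -/
abbrev Table (G : GraphInstance) : Type := Question G → Answer

open Classical in
/-- The probability that the verifier accepts two deterministic provers. -/
def detAccept2 (G : GraphInstance) (f : Table G × Table G) : ℝ :=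
  ∑ q, ∑ q', challengeProb G q q' * (if Accepts2 G q q' (f.1 q) (f.2 q') then 1 else 0)

/-- A strategy of two classical provers with shared (and private) randomness: a probability
distribution on pairs of deterministic strategies. -/
abbrev ClassicalStrategy (G : GraphInstance) : Type := PMF (Table G × Table G)

/-- The probability that the verifier of the two-prover protocol accepts. -/
def classicalAcceptProb (G : GraphInstance) (μ : ClassicalStrategy G) : ℝ :=
  ∑ f, (μ f).toReal * detAccept2 G f

/-! ### The three-prover protocol -/

/-- The distribution of the three challenges: the first two follow `D_G`, and the third one is a
copy of the first or of the second, with probability one half each. -/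
def challengeProb3 (G : GraphInstance) (q q' q'' : Question G) : ℝ :=
  challengeProb G q q' * ((if q'' = q then 1 / 2 else 0) + (if q'' = q' then 1 / 2 else 0))

/-- The check of the three-prover protocol: consistency of the third prover with each of the first
two, and the check of the two-prover protocol for the first two. -/
def Accepts3 (G : GraphInstance) (q q' q'' : Question G) (a a' a'' : Answer) : Prop :=
  (q = q'' → a = a'') ∧ (q' = q'' → a' = a'') ∧ Accepts2 G q q' a a'

/-- The label table `l_i^0 = l i`, `l_i^1 = π (c i) - l i` by which the honest provers answer. -/
def honestTable (G : GraphInstance) (c : Fin G.n → ZMod 3) (π : Equiv.Perm (ZMod 3))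
    (l : Fin G.n → ZMod 3) : Table G := fun q =>
  let lab : Fin G.n → ZMod 3 := fun i => if q.2 then π (c i) - l i else l i
  (lab (G.end1 q.1), lab (G.end2 q.1))

open Classical in
/-- The probability that the verifier accepts three honest provers who hold the colouring `c` and
share a uniformly random permutation of the colours and uniformly random labels. -/
def honestAcceptProb3 (G : GraphInstance) (c : Fin G.n → ZMod 3) : ℝ :=
  (∑ π : Equiv.Perm (ZMod 3), ∑ l : Fin G.n → ZMod 3, ∑ q, ∑ q', ∑ q'',
    challengeProb3 G q q' q'' *
      (if Accepts3 G q q' q'' (honestTable G c π l q) (honestTable G c π l q')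
        (honestTable G c π l q'') then 1 else 0)) /
    (Fintype.card (Equiv.Perm (ZMod 3)) * Fintype.card (Fin G.n → ZMod 3))

/-- A strategy of three entangled provers. The register of prover `i` is an answer register
together with an arbitrary finite-dimensional workspace `Mᵢ`. The provers share the state `ρ`; on
challenge `q`, prover `i` applies the unitary `Uᵢ q` to its own register, and its answer is the
outcome of measuring the answer register in the computational basis. -/
structure QuantumStrategy (G : GraphInstance) where
  (M₁ M₂ M₃ : Type)
  [fin₁ : Fintype M₁] [fin₂ : Fintype M₂] [fin₃ : Fintype M₃]
  [dec₁ : DecidableEq M₁] [dec₂ : DecidableEq M₂] [dec₃ : DecidableEq M₃]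
  U₁ : Question G → Matrix.unitaryGroup (Answer × M₁) ℂ
  U₂ : Question G → Matrix.unitaryGroup (Answer × M₂) ℂ
  U₃ : Question G → Matrix.unitaryGroup (Answer × M₃) ℂ
  ρ : Matrix ((Answer × M₁) × (Answer × M₂) × (Answer × M₃))
    ((Answer × M₁) × (Answer × M₂) × (Answer × M₃)) ℂ
  posSemidef : ρ.PosSemidef
  trace_eq_one : ρ.trace = 1

attribute [instance] QuantumStrategy.fin₁ QuantumStrategy.fin₂ QuantumStrategy.fin₃
  QuantumStrategy.dec₁ QuantumStrategy.dec₂ QuantumStrategy.dec₃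

/-- The projector `U† (|a⟩⟨a| ⊗ 1) U`: apply `U`, find the answer `a` in the answer register, and
undo `U`. -/
def answerProj {M : Type} [Fintype M] [DecidableEq M]
    (U : Matrix.unitaryGroup (Answer × M) ℂ) (a : Answer) :
    Matrix (Answer × M) (Answer × M) ℂ :=
  (U : Matrix (Answer × M) (Answer × M) ℂ).conjTranspose *
    Matrix.diagonal (fun x : Answer × M => if x.1 = a then (1 : ℂ) else 0) *
    (U : Matrix (Answer × M) (Answer × M) ℂ)

namespace QuantumStrategy

variable {G : GraphInstance}

/-- The index type of the joint register of the three provers. -/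
abbrev Joint (S : QuantumStrategy G) : Type :=
  (Answer × S.M₁) × (Answer × S.M₂) × (Answer × S.M₃)

/-- The probability of the answers `a, a', a''` to the challenges `q, q', q''`. -/
def answerProb (S : QuantumStrategy G) (q q' q'' : Question G) (a a' a'' : Answer) : ℝ :=
  ((answerProj (S.U₁ q) a ⊗ₖ (answerProj (S.U₂ q') a' ⊗ₖ answerProj (S.U₃ q'') a'')) *
    S.ρ).trace.re

open Classical in
/-- The probability that the verifier of the three-prover protocol accepts. -/
def acceptProb (S : QuantumStrategy G) : ℝ :=
  ∑ q, ∑ q', ∑ q'', challengeProb3 G q q' q'' *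
    ∑ a, ∑ a', ∑ a'', S.answerProb q q' q'' a a' a'' *
      (if Accepts3 G q q' q'' a a' a'' then 1 else 0)

/-- The operation on the joint register when prover `i` (counted from `0`) is activated on the
challenge `q`, its answer is measured with outcome `a`, and the prover is rewound. -/
def rewindOp (S : QuantumStrategy G) (i : Fin 3) (q : Question G) (a : Answer) :
    Matrix S.Joint S.Joint ℂ :=
  match i with
  | 0 => answerProj (S.U₁ q) a ⊗ₖ (1 ⊗ₖ 1)
  | 1 => 1 ⊗ₖ (answerProj (S.U₂ q) a ⊗ₖ 1)
  | 2 => 1 ⊗ₖ (1 ⊗ₖ answerProj (S.U₃ q) a)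

/-- Activate, measure and rewind the provers along the list of calls, starting from the
unnormalised state `σ`, and append the answers to those already recorded. The result is the expected
value of `out`, a function of the recorded answers. -/
def runCalls (S : QuantumStrategy G) (out : List Answer → ℝ) :
    List (Fin 3 × Question G) → List Answer → Matrix S.Joint S.Joint ℂ → ℝ
  | [], rec, σ => σ.trace.re * out rec
  | call :: calls, rec, σ =>
      ∑ a : Answer, S.runCalls out calls (rec ++ [a])
        (S.rewindOp call.1 call.2 a * σ * (S.rewindOp call.1 call.2 a).conjTranspose)

end QuantumStrategy

/-! ### Extractors -/

/-- Self-delimiting unary code of a natural number. -/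
def encodeUnary (k : ℕ) : List Bool := List.replicate k true ++ [false]

/-- The graph as a bit string. -/
def GraphInstance.encode (G : GraphInstance) : List Bool :=
  encodeUnary G.n ++ encodeUnary G.m ++
    (List.finRange G.m).flatMap fun k => encodeUnary (G.end1 k) ++ encodeUnary (G.end2 k)

/-- The length of the input `G`. -/
def GraphInstance.size (G : GraphInstance) : ℕ := G.encode.length

def encodeAnswer (a : Answer) : List Bool := encodeUnary a.1.val ++ encodeUnary a.2.val

/-- Every bit string is read as a colour assignment, two bits for each vertex. -/
def decodeColors (n : ℕ) (s : List Bool) : Fin n → ZMod 3 := fun v =>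
  if s.getD (2 * v + 1) false then 2 else if s.getD (2 * v) false then 1 else 0

/-- All challenges: every edge, with both bits. -/
def questions (G : GraphInstance) : List (Question G) :=
  (List.finRange G.m).flatMap fun k => [(k, false), (k, true)]

/-- An extractor for the two-prover protocol. As the random tape of the provers stays fixed under
rewinding, access to the provers amounts to access to the tables of their answers to all challenges.
The machine `run` reads the graph, the tables and its own random bits (their number is a polynomial
in the length of the rest of the input) and writes a colouring. -/
structure ClassicalExtractor where
  coins : Polynomial ℕ
  run : List Bool → List Bool

namespace ClassicalExtractor

/-- The machine is a deterministic polynomial-time Turing machine. -/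
def IsPolyTime (K : ClassicalExtractor) : Prop :=
  Nonempty (Turing.TM2ComputableInPolyTime (id : List Bool → List Bool)
    (id : List Bool → List Bool) K.run)

/-- The input without the random bits. -/
def input (G : GraphInstance) (answers : List Answer) : List Bool :=
  G.encode ++ answers.flatMap encodeAnswer

open Classical in
/-- The probability, over the random bits of the extractor, of a proper 3-colouring as output. -/
def successProb (K : ClassicalExtractor) (G : GraphInstance) (answers : List Answer) : ℝ :=
  ((Finset.univ.filter fun r : Fin (K.coins.eval (input G answers).length) → Bool =>
      G.IsColoring (decodeColors G.n (K.run (input G answers ++ List.ofFn r)))).card : ℝ) /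
    2 ^ (K.coins.eval (input G answers).length)

/-- The probability that the extractor obtains a proper 3-colouring from classical provers. -/
def extractProb (K : ClassicalExtractor) (G : GraphInstance) (μ : ClassicalStrategy G) : ℝ :=
  ∑ f, (μ f).toReal *
    K.successProb G ((questions G).map f.1 ++ (questions G).map f.2)

end ClassicalExtractor

/-- Programs for the quantum phase of an extractor for the three-prover protocol. One program serves
all graphs. `activate i b` sends the current edge with the bit `b` to prover `i`, records the
measured answer, and rewinds that prover; `forEdges` runs its body for every edge. -/
inductive RecordProgram : Type
  | activate (i : Fin 3) (b : Bool) : RecordProgram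
  | seq (s t : RecordProgram) : RecordProgram
  | forEdges (s : RecordProgram) : RecordProgram

namespace RecordProgram

/-- The calls that the program makes, with `k` as the current edge. -/
def callsAt (G : GraphInstance) : RecordProgram → Fin G.m → List (Fin 3 × Question G)
  | activate i b, k => [(i, (k, b))]
  | seq s t, k => s.callsAt G k ++ t.callsAt G k
  | forEdges s, _ => (List.finRange G.m).flatMap fun k => s.callsAt G k

/-- The calls that the program makes, starting with the first edge as the current one. -/
def calls (s : RecordProgram) (G : GraphInstance) : List (Fin 3 × Question G) :=
  s.callsAt G ⟨0, G.pos⟩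

end RecordProgram

/-- An extractor for the three-prover protocol: a quantum phase that records answers of rewound
provers, and a classical machine that is run on the recorded answers. -/
structure QuantumExtractor where
  record : RecordProgram
  post : ClassicalExtractor

namespace QuantumExtractor

/-- The number of oracle gates: each call activates a prover and then applies the inverse. -/
def oracleGates (K : QuantumExtractor) (G : GraphInstance) : ℕ := 2 * (K.record.calls G).length

/-- Polynomially many oracle gates and polynomial-time classical computation. -/
def IsPolyTime (K : QuantumExtractor) : Prop :=
  (∃ P : Polynomial ℕ, ∀ G : GraphInstance, K.oracleGates G ≤ P.eval G.size) ∧ K.post.IsPolyTime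

/-- The probability that the extractor obtains a proper 3-colouring from entangled provers. -/
def extractProb (K : QuantumExtractor) (G : GraphInstance) (S : QuantumStrategy G) : ℝ :=
  S.runCalls (K.post.successProb G) (K.record.calls G) [] S.ρ

end QuantumExtractor

/-- For every edge, ask prover `i` this edge with both bits. -/
def sweep (i : Fin 3) : RecordProgram := .forEdges (.seq (.activate i false) (.activate i true))

/-- The extractor for the three-prover protocol: record the answers of the first prover to all
challenges, then those of the second prover, rewinding after each answer, and run the two-prover
extractor `K` on the two recorded tables. -/
def recordingExtractor (K : ClassicalExtractor) : QuantumExtractor where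
  record := .seq (sweep 0) (sweep 1)
  post := K

/-! ### Knowledge error -/

/-- Validity with knowledge error `κ` on the graphs in `𝒢`, for the acceptance probability `acc` and
the probability `ext` of extracting a witness, as functions of the strategy of the provers. -/
def HasKnowledgeError (𝒢 : Set GraphInstance) {Strategy : GraphInstance → Type*}
    (acc ext : ∀ G, Strategy G → ℝ) (κ : GraphInstance → ℝ) : Prop :=
  ∃ d : ℝ, 0 < d ∧ ∃ p : ℕ → ℝ, (∀ η, 0 < p η) ∧
    (∃ P : Polynomial ℕ, ∀ η, p η ≤ (P.eval η : ℕ)) ∧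
    ∀ (l : Polynomial ℕ) (η : ℕ), ∀ G ∈ 𝒢, G.size ≤ l.eval η → ∀ s : Strategy G,
      acc G s > κ G → ext G s ≥ 1 / p η * (acc G s - κ G) ^ d

/-- `K` is an extractor for the two-prover protocol against classical provers, with knowledge error
`κ` on the graphs in `𝒢`. -/
structure IsClassicalExtractor (𝒢 : Set GraphInstance) (K : ClassicalExtractor)
    (κ : GraphInstance → ℝ) : Prop where
  polyTime : K.IsPolyTime
  validity : HasKnowledgeError 𝒢 classicalAcceptProb K.extractProb κ

/-- The three-prover protocol is, on the graphs in `𝒢`, a quantum proof of knowledge of a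
3-colouring with knowledge error `κ` and with the extractor `K`. -/
structure IsQuantumProofOfKnowledge (𝒢 : Set GraphInstance) (K : QuantumExtractor)
    (κ : GraphInstance → ℝ) : Prop where
  nontriviality : ∀ G ∈ 𝒢, ∀ c, G.IsColoring c → honestAcceptProb3 G c = 1
  polyTime : K.IsPolyTime
  validity : HasKnowledgeError 𝒢 (fun _ S => S.acceptProb) K.extractProb κ

/-- The classical knowledge error `κ_c = 1 - 1 / (3|H|)`. -/
def classicalKnowledgeError (G : GraphInstance) : ℝ := 1 - 1 / (3 * G.m)

end ThreeCol

end

open scoped Kronecker ComplexOrder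

noncomputable section

namespace ThreeCol

/-! ### Sharp measurements and recorded sequences of measurements -/

section Measurements

set_option linter.unusedSectionVars false

variable {J α κ : Type*} [Fintype J] [DecidableEq J] [Fintype α]

/-! The recorded tables are themselves a classical strategy, `recordedStrategy`, and extracting from
the entangled provers is exactly extracting from it (`extractProb_recordingExtractor`). It remains
to see that these tables pass the two-prover check almost as often as the entangled provers are
accepted (`classicalAcceptProb_recordedStrategy_ge`).

The obstacle is that recording an answer disturbs the state; the third prover limits this. It holds
its own register, and high acceptance makes it agree with provers 1 and 2 on an average challenge
(`acceptProb_le_sum_agreeProb`). An outcome predicted by a commuting measurement `R` can be measured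
gently: an effect commuting with `R` loses at most `s + 2(1 + 1/s)(1 - agreement)`, for any `s > 0`
(`expect_sum_conj_ge`). In the Heisenberg picture, effects pulled back through measurements of
provers 1 and 2 still commute with prover 3, so the losses add up, with every agreement taken in the
initial state (`expect_pullback_ge`).

For fixed challenges, only the recordings made earlier by the same prover matter
(`sum_tableWeight_accepts_ge`). The total loss is at most `4|H|s + (1 + 1/s)·8|H|(1 - p_acc)`, and
`s = 1/(30|H|²)` keeps it below `δ` whenever `p_acc` exceeds the claimed knowledge error. -/

/-- A projective measurement with outcomes in `α`. -/
structure IsSharp (A : α → Matrix J J ℂ) : Prop where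
  herm : ∀ a, (A a).IsHermitian
  idem : ∀ a, A a * A a = A a
  sum_eq_one : ∑ a, A a = 1

/-- The expected value of the observable `X` in the state `ρ`. -/
def expect (ρ X : Matrix J J ℂ) : ℝ := (X * ρ).trace.re

theorem expect_add (ρ X Y : Matrix J J ℂ) : expect ρ (X + Y) = expect ρ X + expect ρ Y := by
  simp [expect, Matrix.add_mul]

theorem expect_sub (ρ X Y : Matrix J J ℂ) : expect ρ (X - Y) = expect ρ X - expect ρ Y := by
  simp [expect, Matrix.sub_mul]

theorem expect_smul (ρ : Matrix J J ℂ) (r : ℝ) (X : Matrix J J ℂ) :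
    expect ρ (r • X) = r * expect ρ X := by
  simp [expect]

theorem expect_sum {ι : Type*} (ρ : Matrix J J ℂ) (s : Finset ι) (X : ι → Matrix J J ℂ) :
    expect ρ (∑ i ∈ s, X i) = ∑ i ∈ s, expect ρ (X i) := by
  simp [expect, Matrix.sum_mul, Matrix.trace_sum]

open scoped MatrixOrder in
theorem expect_nonneg {ρ X : Matrix J J ℂ} (hρ : ρ.PosSemidef) (hX : X.PosSemidef) :
    0 ≤ expect ρ X := by
  obtain ⟨B, rfl⟩ := CStarAlgebra.nonneg_iff_eq_star_mul_self.1 hX.nonneg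
  have h : (B * ρ * B.conjTranspose).PosSemidef := hρ.mul_mul_conjTranspose_same B
  have h2 := h.trace_nonneg
  rw [Matrix.star_eq_conjTranspose]
  rw [expect, Matrix.mul_assoc, Matrix.trace_mul_comm]
  exact (Complex.le_def.1 h2).1

theorem IsSharp.posSemidef {A : α → Matrix J J ℂ} (hA : IsSharp A) (a : α) :
    (A a).PosSemidef := by
  have h := Matrix.posSemidef_conjTranspose_mul_self (A a)
  rwa [(hA.herm a).eq, hA.idem] at h

theorem posSemidef_herm_conj {A X : Matrix J J ℂ} (hA : A.IsHermitian) (hX : X.PosSemidef) :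
    (A * X * A).PosSemidef := by
  have := hX.mul_mul_conjTranspose_same A
  rwa [hA.eq] at this

theorem posSemidef_real_smul {X : Matrix J J ℂ} (hX : X.PosSemidef) {r : ℝ} (hr : 0 ≤ r) :
    (r • X).PosSemidef := by
  have := hX.smul (a := (r : ℂ)) (by exact_mod_cast hr)
  have e : (r : ℂ) • X = r • X := by
    ext i j
    simp
  rwa [e] at this

/-- If the measurements `P` and `R` commute and agree with high probability, then the measurement `P`
hardly decreases the expected value of an effect that commutes with `R`. -/
theorem expect_sum_conj_ge {ρ : Matrix J J ℂ} (hρ : ρ.PosSemidef) (h1 : expect ρ 1 = 1)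
    {P R : α → Matrix J J ℂ} (hP : IsSharp P) (hR : IsSharp R)
    (hPR : ∀ a, Commute (P a) (R a)) {Y : Matrix J J ℂ} (hY : Y.PosSemidef)
    (hY1 : (1 - Y).PosSemidef) (hYR : ∀ a, Commute Y (R a)) {s : ℝ} (hs : 0 < s) :
    expect ρ Y - (s + (1 + 1 / s) * (2 * (1 - ∑ a, expect ρ (P a * R a)))) ≤
      expect ρ (∑ a, P a * Y * P a) := by
  have hD : ∀ a, (P a - R a).IsHermitian := fun a => (hP.herm a).sub (hR.herm a)
  -- Put `D = P - R`. Since `R` is a projection commuting with `Y`, `Y R = R Y R = (P - D) Y (P -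
  -- D)`. Weighting the cross terms by `s` bounds this by `(1 + s) P Y P + (1 + 1/s) D Y D`, and `Y
  -- ≤ 1` gives `P Y P + s P + (1 + 1/s) D²`. The three positivity facts `e1`, `e2`, `e3` enter with
  -- weights `1/s`, `1 + 1/s` and `s`.
  have hmain : ∀ a, expect ρ (Y * R a) ≤ expect ρ (P a * Y * P a) + s * expect ρ (P a)
      + (1 + 1 / s) * (expect ρ (P a) + expect ρ (R a) - 2 * expect ρ (P a * R a)) := by
    intro a
    have e1 : (0:ℝ) ≤ expect ρ ((s • P a + (P a - R a)) * Y * (s • P a + (P a - R a))) := by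
      refine expect_nonneg hρ (posSemidef_herm_conj ?_ hY)
      refine Matrix.IsHermitian.add ?_ (hD a)
      simp [Matrix.IsHermitian, (hP.herm a).eq]
    have e2 := expect_nonneg hρ (posSemidef_herm_conj (hD a) hY1)
    have e3 := expect_nonneg hρ (posSemidef_herm_conj (hP.herm a) hY1)
    have hRY : R a * Y * R a = Y * R a := by
      rw [← (hYR a).eq, Matrix.mul_assoc, hR.idem]
    have hRP : R a * P a = P a * R a := (hPR a).eq.symm
    have x1 : (s • P a + (P a - R a)) * Y * (s • P a + (P a - R a)) =
        (s ^ 2 + 2 * s + 1) • (P a * Y * P a) - (s + 1) • (P a * Y * R a)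
          - (s + 1) • (R a * Y * P a) + Y * R a := by
      rw [← hRY]
      simp only [Matrix.add_mul, Matrix.mul_add, Matrix.sub_mul, Matrix.mul_sub, Matrix.smul_mul,
        Matrix.mul_smul]
      module
    have x2 : (P a - R a) * (1 - Y) * (P a - R a) =
        P a + R a - (2 : ℝ) • (P a * R a) - P a * Y * P a + P a * Y * R a + R a * Y * P a
          - Y * R a := by
      rw [← hRY]
      simp only [Matrix.mul_sub, Matrix.sub_mul, Matrix.mul_one, hP.idem, hR.idem, hRP]
      module
    have x3 : P a * (1 - Y) * P a = P a - P a * Y * P a := by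
      simp only [Matrix.mul_sub, Matrix.sub_mul, Matrix.mul_one, hP.idem]
    rw [x1] at e1
    rw [x2] at e2
    rw [x3] at e3
    simp only [expect_add, expect_sub, expect_smul] at e1 e2 e3
    have e1' := mul_nonneg (one_div_pos.2 hs).le e1
    have e2' := mul_nonneg (by positivity : (0:ℝ) ≤ 1 + 1 / s) e2
    have e3' := mul_nonneg hs.le e3
    have hs' : 1 / s * s = 1 := by field_simp
    generalize 1 / s = t at *
    have hst2 : t * s ^ 2 = s := by rw [pow_two, ← mul_assoc, hs', one_mul]
    linear_combination e1' + e2' + e3' +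
      (2 * expect ρ (P a * Y * P a) - expect ρ (P a * Y * R a) - expect ρ (R a * Y * P a)) * hs'
      + expect ρ (P a * Y * P a) * hst2
  have hs1 := Finset.sum_le_sum fun a (_ : a ∈ Finset.univ) => hmain a
  simp only [Finset.sum_add_distrib, ← Finset.mul_sum, Finset.sum_sub_distrib, ← expect_sum,
    hP.sum_eq_one, hR.sum_eq_one, Matrix.mul_one, h1] at hs1
  rw [← expect_sum]
  linarith

/-! ### Sequences of measurements in the Heisenberg picture -/

variable (A : κ → α → Matrix J J ℂ)

/-- The observable that is measured by performing the measurements of a list one after the other and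
then observing `X l`, where `l` is the list of the outcomes. -/
def pullback : List κ → (List α → Matrix J J ℂ) → Matrix J J ℂ
  | [], X => X []
  | c :: cs, X => ∑ a, A c a * pullback cs (fun l => X (a :: l)) * A c a

variable {A}

/-- Only outcome lists of the length of `L` can occur, so other values of the observable never
enter. -/
theorem pullback_congr {L : List κ} {X Y : List α → Matrix J J ℂ}
    (h : ∀ l, l.length = L.length → X l = Y l) : pullback A L X = pullback A L Y := by
  induction L generalizing X Y with
  | nil => exact h [] rfl
  | cons c cs ih =>
    simp only [pullback]
    refine Finset.sum_congr rfl fun a _ => ?_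
    rw [ih fun l hl => h (a :: l) (by simp [hl])]

theorem pullback_append (L L' : List κ) (X : List α → Matrix J J ℂ) :
    pullback A (L ++ L') X = pullback A L fun l => pullback A L' fun l' => X (l ++ l') := by
  induction L generalizing X with
  | nil => rfl
  | cons c cs ih => simp [pullback, ih]

theorem pullback_sum {ι : Type*} (s : Finset ι) (L : List κ) (X : ι → List α → Matrix J J ℂ) :
    pullback A L (fun l => ∑ i ∈ s, X i l) = ∑ i ∈ s, pullback A L (X i) := by
  induction L generalizing X with
  | nil => rfl
  | cons c cs ih =>
    simp only [pullback, ih, Matrix.mul_sum, Matrix.sum_mul]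
    exact Finset.sum_comm

theorem pullback_smul (r : ℝ) (L : List κ) (X : List α → Matrix J J ℂ) :
    pullback A L (fun l => r • X l) = r • pullback A L X := by
  induction L generalizing X with
  | nil => rfl
  | cons c cs ih => simp [pullback, ih, Finset.smul_sum]

theorem pullback_sub (L : List κ) (X Y : List α → Matrix J J ℂ) :
    pullback A L (fun l => X l - Y l) = pullback A L X - pullback A L Y := by
  induction L generalizing X Y with
  | nil => rfl
  | cons c cs ih => simp [pullback, ih, Matrix.mul_sub, Matrix.sub_mul]

theorem pullback_commute {L : List κ} {X : List α → Matrix J J ℂ} {Z : Matrix J J ℂ}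
    (hX : ∀ l, Commute Z (X l)) (hZ : ∀ c ∈ L, ∀ a, Commute Z (A c a)) :
    Commute Z (pullback A L X) := by
  induction L generalizing X with
  | nil => exact hX []
  | cons c cs ih =>
    refine Commute.sum_right _ _ _ fun a _ => ?_
    have h1 := hZ c (by simp) a
    exact (h1.mul_right (ih (fun l => hX _) fun c hc => hZ c (by simp [hc]))).mul_right h1

theorem pullback_mul_left {L : List κ} {X : List α → Matrix J J ℂ} {Z : Matrix J J ℂ}
    (hZ : ∀ c ∈ L, ∀ a, Commute Z (A c a)) :
    pullback A L (fun l => Z * X l) = Z * pullback A L X := by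
  induction L generalizing X with
  | nil => rfl
  | cons c cs ih =>
    simp only [pullback, Matrix.mul_sum]
    refine Finset.sum_congr rfl fun a _ => ?_
    rw [ih fun c hc => hZ c (by simp [hc]), ← Matrix.mul_assoc, ← (hZ c (by simp) a).eq]
    simp only [Matrix.mul_assoc]

/-- Commutation and idempotence turn `A Z A` into `Z A`, which sums to `Z`. This removes
measurements on registers that an effect does not touch; `Z = 1` gives normalisation. -/
theorem pullback_const (hA : ∀ c, IsSharp (A c)) {L : List κ} {Z : Matrix J J ℂ}
    (hZ : ∀ c ∈ L, ∀ a, Commute Z (A c a)) : pullback A L (fun _ => Z) = Z := by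
  induction L with
  | nil => rfl
  | cons c cs ih =>
    simp only [pullback]
    rw [ih fun c hc => hZ c (by simp [hc])]
    have : ∀ a, A c a * Z * A c a = Z * A c a := fun a => by
      rw [← (hZ c (by simp) a).eq, Matrix.mul_assoc, (hA c).idem]
    simp only [this, ← Matrix.mul_sum, (hA c).sum_eq_one, Matrix.mul_one]

theorem pullback_posSemidef (hA : ∀ c, IsSharp (A c)) (L : List κ) {X : List α → Matrix J J ℂ}
    (hX : ∀ l, (X l).PosSemidef) : (pullback A L X).PosSemidef := by
  induction L generalizing X with
  | nil => exact hX []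
  | cons c cs ih =>
    exact Matrix.posSemidef_sum _ fun a _ => posSemidef_herm_conj ((hA c).herm a) (ih fun l => hX _)

/-- Measurements whose outcomes could be predicted well by the commuting measurements `R` hardly
decrease the expected value of an effect that commutes with `R`. -/
theorem expect_pullback_ge (hA : ∀ c, IsSharp (A c)) {ρ : Matrix J J ℂ} (hρ : ρ.PosSemidef)
    (h1 : expect ρ 1 = 1) {R : κ → α → Matrix J J ℂ} (hR : ∀ c, IsSharp (R c)) {L : List κ}
    (hAR : ∀ c ∈ L, ∀ c' a a', Commute (A c a) (R c' a'))
    {X : Matrix J J ℂ} (hX : X.PosSemidef) (hX1 : (1 - X).PosSemidef)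
    (hXR : ∀ c a, Commute X (R c a)) {s : ℝ} (hs : 0 < s) :
    expect ρ X - (L.map fun c =>
        s + (1 + 1 / s) * (2 * (1 - ∑ a, expect ρ (A c a * R c a)))).sum ≤
      expect ρ (pullback A L fun _ => X) := by
  induction L with
  | nil => simp [pullback]
  | cons c cs ih =>
    have hcs : ∀ c ∈ cs, ∀ c' a a', Commute (A c a) (R c' a') := fun c hc => hAR c (by simp [hc])
    have hle : (1 - pullback A cs fun _ => X).PosSemidef := by
      have h := pullback_posSemidef hA cs (X := fun _ => 1 - X) fun _ => hX1
      rwa [pullback_sub, pullback_const hA fun c _ a => Commute.one_left _] at h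
    -- The whole remaining sequence plays the role of `Y`, so the loss caused by `c` is charged to
    -- `ρ` itself and not to a post-measurement state.
    have key := expect_sum_conj_ge hρ h1 (hA c) (hR c) (fun a => hAR c (by simp) c a a)
      (pullback_posSemidef hA cs (X := fun _ => X) fun _ => hX) hle
      (fun a => (pullback_commute (fun _ => (hXR c a).symm)
        fun c' hc' a' => (hcs c' hc' c a' a).symm).symm) hs
    have := ih hcs
    simp only [List.map_cons, List.sum_cons, pullback]
    linarith

end Measurements

/-! ### The measurements of the provers -/

theorem answerProj_isSharp {M : Type} [Fintype M] [DecidableEq M]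
    (U : Matrix.unitaryGroup (Answer × M) ℂ) : IsSharp (answerProj U) := by
  have h1 : (U : Matrix (Answer × M) (Answer × M) ℂ).conjTranspose * U = 1 :=
    Matrix.mem_unitaryGroup_iff'.1 U.2
  have h2 : (U : Matrix (Answer × M) (Answer × M) ℂ) *
      (U : Matrix (Answer × M) (Answer × M) ℂ).conjTranspose = 1 :=
    Matrix.mem_unitaryGroup_iff.1 U.2
  refine ⟨fun a => ?_, fun a => ?_, ?_⟩
  · refine Matrix.isHermitian_conjTranspose_mul_mul _ (Matrix.isHermitian_diagonal_iff.2 fun x => ?_)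
    split_ifs <;> simp [IsSelfAdjoint]
  · calc answerProj U a * answerProj U a
        = (U : Matrix (Answer × M) (Answer × M) ℂ).conjTranspose *
          (Matrix.diagonal (fun x : Answer × M => if x.1 = a then (1 : ℂ) else 0) *
            ((U : Matrix (Answer × M) (Answer × M) ℂ) *
              (U : Matrix (Answer × M) (Answer × M) ℂ).conjTranspose) *
            Matrix.diagonal (fun x : Answer × M => if x.1 = a then (1 : ℂ) else 0)) * U := by
          simp only [answerProj, Matrix.mul_assoc]
      _ = answerProj U a := by
          rw [h2, Matrix.mul_one, Matrix.diagonal_mul_diagonal]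
          simp only [← ite_and, and_self, mul_ite, mul_one, mul_zero, answerProj, Matrix.mul_assoc]
  · simp only [answerProj, ← Matrix.mul_sum, ← Matrix.sum_mul]
    have : (∑ a : Answer, Matrix.diagonal fun x : Answer × M => if x.1 = a then (1 : ℂ) else 0)
        = 1 := by
      ext x y
      rw [Matrix.sum_apply]
      by_cases h : x = y
      · subst h; simp
      · simp [h]
    rw [this, Matrix.mul_one, h1]

section Kronecker

variable {m n α : Type*} [Fintype m] [Fintype n] [DecidableEq m] [DecidableEq n] [Fintype α]

theorem IsSharp.kronecker_one {A : α → Matrix m m ℂ} (hA : IsSharp A) :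
    IsSharp fun a => A a ⊗ₖ (1 : Matrix n n ℂ) where
  herm a := by
    rw [Matrix.IsHermitian, Matrix.conjTranspose_kronecker, (hA.herm a).eq,
      Matrix.conjTranspose_one]
  idem a := by rw [← Matrix.mul_kronecker_mul, hA.idem, Matrix.mul_one]
  sum_eq_one := by
    rw [← Matrix.one_kronecker_one, ← hA.sum_eq_one]
    ext i j
    simp [Matrix.sum_apply, Finset.sum_mul]

theorem IsSharp.one_kronecker {A : α → Matrix m m ℂ} (hA : IsSharp A) :
    IsSharp fun a => (1 : Matrix n n ℂ) ⊗ₖ A a where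
  herm a := by
    rw [Matrix.IsHermitian, Matrix.conjTranspose_kronecker, (hA.herm a).eq,
      Matrix.conjTranspose_one]
  idem a := by rw [← Matrix.mul_kronecker_mul, hA.idem, Matrix.mul_one]
  sum_eq_one := by
    rw [← Matrix.one_kronecker_one, ← hA.sum_eq_one]
    ext i j
    simp [Matrix.sum_apply, Finset.mul_sum]

end Kronecker

namespace QuantumStrategy

variable {G : GraphInstance} (S : QuantumStrategy G)

/-- The measurement performed by a call: prover `c.1` is asked the challenge `c.2`. -/
def callOp (c : Fin 3 × Question G) (a : Answer) : Matrix S.Joint S.Joint ℂ :=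
  S.rewindOp c.1 c.2 a

theorem callOp_isSharp (c : Fin 3 × Question G) : IsSharp (S.callOp c) := by
  obtain ⟨i, q⟩ := c
  fin_cases i
  · have := (answerProj_isSharp (S.U₁ q)).kronecker_one (n := (Answer × S.M₂) × (Answer × S.M₃))
    rwa [← Matrix.one_kronecker_one] at this
  · exact (answerProj_isSharp (S.U₂ q)).kronecker_one.one_kronecker
  · exact (answerProj_isSharp (S.U₃ q)).one_kronecker.one_kronecker

theorem callOp_commute {c c' : Fin 3 × Question G} (h : c.1 ≠ c'.1) (a a' : Answer) :
    Commute (S.callOp c a) (S.callOp c' a') := by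
  obtain ⟨i, q⟩ := c
  obtain ⟨j, q'⟩ := c'
  fin_cases i <;> fin_cases j <;>
    simp_all [Commute, SemiconjBy, callOp, rewindOp, ← Matrix.mul_kronecker_mul]

theorem answerProb_eq (q q' q'' : Question G) (a a' a'' : Answer) :
    S.answerProb q q' q'' a a' a'' =
      expect S.ρ (S.callOp (0, q) a * S.callOp (1, q') a' * S.callOp (2, q'') a'') := by
  simp [answerProb, expect, callOp, rewindOp, ← Matrix.mul_kronecker_mul]

/-- For commuting projections, `P Q = Q P Q`. -/
theorem posSemidef_callOp_mul {c c' : Fin 3 × Question G} (h : c.1 ≠ c'.1) (a a' : Answer) :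
    (S.callOp c a * S.callOp c' a').PosSemidef := by
  have := posSemidef_herm_conj ((S.callOp_isSharp c').herm a') ((S.callOp_isSharp c).posSemidef a)
  rwa [← (S.callOp_commute h a a').eq, Matrix.mul_assoc, (S.callOp_isSharp c').idem] at this

theorem answerProb_nonneg (q q' q'' : Question G) (a a' a'' : Answer) :
    0 ≤ S.answerProb q q' q'' a a' a'' := by
  rw [answerProb_eq]
  refine expect_nonneg S.posSemidef ?_
  have h := posSemidef_herm_conj ((S.callOp_isSharp (2, q'')).herm a'')
    (S.posSemidef_callOp_mul (c := (0, q)) (c' := (1, q')) (by simp) a a')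
  have hc := (S.callOp_commute (c := (0, q)) (c' := (2, q'')) (by simp) a a'').mul_left
    (S.callOp_commute (c := (1, q')) (c' := (2, q'')) (by simp) a' a'')
  rwa [← hc.eq, Matrix.mul_assoc, (S.callOp_isSharp (2, q'')).idem] at h

/-- No-signalling: the projectors of an ignored prover sum to the identity, whatever it was asked.
-/
theorem sum_answerProb_third (q q' q'' : Question G) (a a' : Answer) :
    ∑ a'', S.answerProb q q' q'' a a' a'' =
      expect S.ρ (S.callOp (0, q) a * S.callOp (1, q') a') := by
  simp only [answerProb_eq, ← expect_sum, ← Matrix.mul_sum, (S.callOp_isSharp _).sum_eq_one,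
    Matrix.mul_one]

theorem sum_answerProb_second (q q' q'' : Question G) (a a'' : Answer) :
    ∑ a', S.answerProb q q' q'' a a' a'' =
      expect S.ρ (S.callOp (0, q) a * S.callOp (2, q'') a'') := by
  simp only [answerProb_eq, ← expect_sum, ← Matrix.mul_sum, ← Matrix.sum_mul,
    (S.callOp_isSharp _).sum_eq_one, Matrix.mul_one]

theorem sum_answerProb_first (q q' q'' : Question G) (a' a'' : Answer) :
    ∑ a, S.answerProb q q' q'' a a' a'' =
      expect S.ρ (S.callOp (1, q') a' * S.callOp (2, q'') a'') := by
  simp only [answerProb_eq, ← expect_sum, ← Matrix.sum_mul,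
    (S.callOp_isSharp _).sum_eq_one, Matrix.one_mul]

theorem expect_one : expect S.ρ 1 = 1 := by simp [expect, S.trace_eq_one]

/-- The expected output of a sequence of calls is the expected value of an observable. -/
theorem runCalls_eq (out : List Answer → ℝ) (calls : List (Fin 3 × Question G))
    (rec : List Answer) (σ : Matrix S.Joint S.Joint ℂ) :
    S.runCalls out calls rec σ =
      expect σ (pullback S.callOp calls fun l => out (rec ++ l) • 1) := by
  induction calls generalizing rec σ with
  | nil => simp [runCalls, pullback, expect, mul_comm]
  | cons c cs ih =>
    simp only [runCalls, pullback, ih, expect_sum]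
    refine Finset.sum_congr rfl fun a _ => ?_
    have h := ((S.callOp_isSharp c).herm a).eq
    simp only [callOp] at h
    rw [h]
    simp only [List.append_assoc, List.singleton_append, expect]
    congr 1
    rw [← Matrix.mul_assoc, Matrix.trace_mul_comm]
    simp only [Matrix.mul_assoc]
    rfl

/-! ### Agreement with the third prover and the two-prover check -/

/-- The probability that the prover `i` and the third prover answer the challenge `q` alike. -/
def agreeProb (i : Fin 3) (q : Question G) : ℝ :=
  ∑ a, expect S.ρ (S.callOp (i, q) a * S.callOp (2, q) a)

open Classical in
/-- The probability that the first two provers pass the two-prover check on `q, q'`. -/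
def passProb (q q' : Question G) : ℝ :=
  ∑ a, ∑ a', (if Accepts2 G q q' a a' then 1 else 0) *
    expect S.ρ (S.callOp (0, q) a * S.callOp (1, q') a')

open Classical in
/-- The probability that the three provers are accepted on the challenges `q, q', q''`. -/
def acceptProbAt (q q' q'' : Question G) : ℝ :=
  ∑ a, ∑ a', ∑ a'', S.answerProb q q' q'' a a' a'' *
    (if Accepts3 G q q' q'' a a' a'' then 1 else 0)

theorem acceptProbAt_le_passProb (q q' q'' : Question G) :
    S.acceptProbAt q q' q'' ≤ S.passProb q q' := by
  simp only [acceptProbAt, passProb, ← S.sum_answerProb_third q q' q'', Finset.mul_sum]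
  refine Finset.sum_le_sum fun a _ => Finset.sum_le_sum fun a' _ => Finset.sum_le_sum fun a'' _ => ?_
  rw [mul_comm]
  refine mul_le_mul_of_nonneg_right ?_ (S.answerProb_nonneg ..)
  by_cases h : Accepts3 G q q' q'' a a' a''
  · simp [h, h.2.2]
  · rw [if_neg h]
    split_ifs <;> simp

/-- The third challenge copies the first, so acceptance kills every term with `a'' ≠ a`; the second
prover is then summed out. -/
theorem acceptProbAt_le_agreeProb_zero (q q' : Question G) :
    S.acceptProbAt q q' q ≤ S.agreeProb 0 q := by
  simp only [acceptProbAt, agreeProb, ← S.sum_answerProb_second q q' q]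
  gcongr with a _ a' _
  rw [Finset.sum_eq_single a]
  · exact mul_le_of_le_one_right (S.answerProb_nonneg ..) (by split_ifs <;> simp)
  · intro a'' _ h
    rw [if_neg fun h' => h (h'.1 rfl).symm, mul_zero]
  · simp

theorem acceptProbAt_le_agreeProb_one (q q' : Question G) :
    S.acceptProbAt q q' q' ≤ S.agreeProb 1 q' := by
  simp only [acceptProbAt, agreeProb, ← S.sum_answerProb_first q q' q']
  rw [Finset.sum_comm]
  gcongr with a' _ a _
  rw [Finset.sum_eq_single a']
  · exact mul_le_of_le_one_right (S.answerProb_nonneg ..) (by split_ifs <;> simp)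
  · intro a'' _ h
    rw [if_neg fun h' => h (h'.2.1 rfl).symm, mul_zero]
  · simp

/-- Commuting projections satisfy `0 ≤ (P - R)² = P + R - 2 P R`, and the sum over outcomes has
expectation `2 - 2 · agreement`. -/
theorem agreeProb_le_one {i : Fin 3} (hi : i ≠ 2) (q : Question G) : S.agreeProb i q ≤ 1 := by
  have h : ∀ a, 0 ≤ expect S.ρ (S.callOp (i, q) a + S.callOp (2, q) a
      - (2 : ℝ) • (S.callOp (i, q) a * S.callOp (2, q) a)) := by
    intro a
    refine expect_nonneg S.posSemidef ?_
    have hh : (S.callOp (i, q) a - S.callOp (2, q) a).IsHermitian :=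
      ((S.callOp_isSharp _).herm a).sub ((S.callOp_isSharp _).herm a)
    have := Matrix.posSemidef_conjTranspose_mul_self (S.callOp (i, q) a - S.callOp (2, q) a)
    rw [hh.eq] at this
    simp only [Matrix.mul_sub, Matrix.sub_mul, (S.callOp_isSharp _).idem,
      ← (S.callOp_commute (c := (i, q)) (c' := (2, q)) hi a a).eq] at this
    convert this using 1
    module
  have hs := Finset.sum_nonneg fun a (_ : a ∈ Finset.univ) => h a
  simp only [expect_sub, expect_add, expect_smul, Finset.sum_sub_distrib, Finset.sum_add_distrib,
    ← Finset.mul_sum] at hs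
  simp only [← expect_sum _ _ (S.callOp _), (S.callOp_isSharp _).sum_eq_one, expect_one] at hs
  rw [agreeProb]
  linarith

end QuantumStrategy

/-! ### The distribution of the challenges -/

variable (G : GraphInstance)

/-- The two endpoints of an edge are distinct. This rewrites the challenge distribution as a sum
over common endpoints, a form in which its symmetry, and hence the uniformity of the second
marginal, is visible. -/
theorem incident_sum_eq (f : Fin G.n → ℝ) (k k' : Fin G.m) :
    (∑ v, if G.Incident v k ∧ G.Incident v k' then f v else 0) =
      (if G.Incident (G.end1 k) k' then f (G.end1 k) else 0) +
        (if G.Incident (G.end2 k) k' then f (G.end2 k) else 0) := by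
  have h : ∀ v, (if G.Incident v k ∧ G.Incident v k' then f v else 0) =
      (if v = G.end1 k then (if G.Incident v k' then f v else 0) else 0) +
        (if v = G.end2 k then (if G.Incident v k' then f v else 0) else 0) := by
    intro v
    have hne := (G.lt k).ne
    by_cases h1 : v = G.end1 k
    · have h2 : v ≠ G.end2 k := h1 ▸ hne
      have hI : G.Incident v k := Or.inl h1
      simp [hI, ← h1, h2]
    · have hI : G.Incident v k ↔ v = G.end2 k := or_iff_right h1
      simp [hI, h1, ite_and]
  simp [h, Finset.sum_add_distrib]

theorem challengeProb_eq (q q' : Question G) : challengeProb G q q' =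
    (if q'.1 = q.1 ∧ q'.2 ≠ q.2 then evtProb / (2 * G.m) else 0) +
    (if q'.2 = q.2 then (1 - evtProb) / (4 * G.m) *
      ∑ v, if G.Incident v q.1 ∧ G.Incident v q'.1 then 1 / (G.deg v : ℝ) else 0 else 0) := by
  rw [challengeProb, incident_sum_eq G fun v => 1 / (G.deg v : ℝ)]

theorem challengeProb_symm (q q' : Question G) : challengeProb G q q' = challengeProb G q' q := by
  simp only [challengeProb_eq, and_comm (a := G.Incident _ q.1), eq_comm (a := q'.1),
    eq_comm (a := q'.2), ne_eq]

theorem challengeProb_nonneg (q q' : Question G) : 0 ≤ challengeProb G q q' := by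
  rw [challengeProb_eq]
  have h : ∀ v, (0:ℝ) ≤ if G.Incident v q.1 ∧ G.Incident v q'.1 then 1 / (G.deg v : ℝ) else 0 := by
    intro v
    positivity
  have := Finset.sum_nonneg fun v (_ : v ∈ Finset.univ) => h v
  have e1 : (0:ℝ) ≤ evtProb := by norm_num [evtProb]
  have e2 : (0:ℝ) ≤ 1 - evtProb := by norm_num [evtProb]
  positivity

/-- Each of the two endpoints `v` of `k` contributes `deg v` terms `1 / deg v`; the degree is
positive because `k` itself is at `v`. -/
theorem sum_incident_inv_deg (k : Fin G.m) :
    ∑ k', ∑ v, (if G.Incident v k ∧ G.Incident v k' then 1 / (G.deg v : ℝ) else 0) = 2 := by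
  rw [Finset.sum_comm]
  have h : ∀ v, ∑ k', (if G.Incident v k ∧ G.Incident v k' then 1 / (G.deg v : ℝ) else 0) =
      if G.Incident v k ∧ G.Incident v k then 1 else 0 := by
    intro v
    by_cases hv : G.Incident v k
    · have hd : 0 < G.deg v := Finset.card_pos.2 ⟨k, by simpa using hv⟩
      have hd' : (G.deg v : ℝ) ≠ 0 := by positivity
      simp only [hv, true_and, if_true, ← Finset.sum_filter, Finset.sum_const, nsmul_eq_mul]
      exact mul_one_div_cancel hd'
    · simp [hv]
  simp only [h]
  rw [incident_sum_eq G fun _ => 1]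
  simp only [GraphInstance.Incident, true_or, or_true, if_true]
  norm_num

theorem sum_challengeProb_right (q : Question G) :
    ∑ q', challengeProb G q q' = 1 / (2 * G.m) := by
  have hm : (G.m : ℝ) ≠ 0 := by exact_mod_cast G.pos.ne'
  obtain ⟨k, b⟩ := q
  have hs := sum_incident_inv_deg G k
  simp only [one_div] at hs
  simp only [challengeProb_eq, Finset.sum_add_distrib, Fintype.sum_prod_type, Fintype.sum_bool]
  cases b <;> simp [← Finset.mul_sum, hs] <;> field_simp <;> ring

theorem sum_challengeProb_left (q' : Question G) :
    ∑ q, challengeProb G q q' = 1 / (2 * G.m) := by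
  simp only [challengeProb_symm G _ q', sum_challengeProb_right]

theorem sum_challengeProb : ∑ q, ∑ q', challengeProb G q q' = 1 := by
  have hm : (G.m : ℝ) ≠ 0 := by exact_mod_cast G.pos.ne'
  simp only [sum_challengeProb_right, Finset.sum_const, Finset.card_univ, Fintype.card_prod,
    Fintype.card_fin, Fintype.card_bool, nsmul_eq_mul]
  push_cast
  field_simp

theorem sum_challengeProb3 (q q' : Question G) (F : Question G → ℝ) :
    ∑ q'', challengeProb3 G q q' q'' * F q'' =
      challengeProb G q q' * (1 / 2 * F q + 1 / 2 * F q') := by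
  simp only [challengeProb3, mul_assoc, ← Finset.mul_sum, add_mul, Finset.sum_add_distrib, ite_mul,
    zero_mul, Finset.sum_ite_eq', Finset.mem_univ, if_true]

/-! ### Honest provers -/

variable {G}

theorem labelAt_honestTable (c : Fin G.n → ZMod 3) (π : Equiv.Perm (ZMod 3)) (l : Fin G.n → ZMod 3)
    (q : Question G) {v : Fin G.n} (hv : G.Incident v q.1) :
    labelAt G q.1 (honestTable G c π l q) v = if q.2 then π (c v) - l v else l v := by
  rw [labelAt]
  split_ifs with h1 h2 h2
  · simp [honestTable, h1, h2]
  · simp [honestTable, h1, h2]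
  · simp [honestTable, hv.resolve_left h1, h2]
  · simp [honestTable, hv.resolve_left h1, h2]

/-- The two labels of a vertex `i` for opposite bits add up to `π (c i)`, and `π` is injective. For
equal bits the label depends only on the vertex. -/
theorem accepts2_honestTable {c : Fin G.n → ZMod 3} (hc : G.IsColoring c)
    (π : Equiv.Perm (ZMod 3)) (l : Fin G.n → ZMod 3) (q q' : Question G) :
    Accepts2 G q q' (honestTable G c π l q) (honestTable G c π l q') := by
  refine ⟨fun ⟨h1, h2⟩ => ?_, fun h v hv hv' => ?_⟩
  · obtain ⟨k, b⟩ := q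
    obtain ⟨k', b'⟩ := q'
    obtain rfl : k = k' := h1
    have hne : π (c (G.end1 k)) ≠ π (c (G.end2 k)) := fun h => hc k (π.injective h)
    cases b <;> cases b' <;> simp_all [honestTable]
  · rw [labelAt_honestTable c π l q hv, labelAt_honestTable c π l q' hv', h]

theorem honestAcceptProb3_eq_one {c : Fin G.n → ZMod 3} (hc : G.IsColoring c) :
    honestAcceptProb3 G c = 1 := by
  have h : ∀ π l q q' q'', Accepts3 G q q' q'' (honestTable G c π l q) (honestTable G c π l q')
      (honestTable G c π l q'') := fun π l q q' q'' =>
    ⟨fun e => by rw [e], fun e => by rw [e], accepts2_honestTable hc π l q q'⟩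
  have h3 := fun q q' => sum_challengeProb3 G q q' fun _ => 1
  simp only [honestAcceptProb3, h, if_true, h3]
  norm_num [sum_challengeProb]

/-! ### Recorded tables of answers -/

variable (G)

theorem mem_questions (q : Question G) : q ∈ questions G := by
  obtain ⟨k, b⟩ := q
  cases b <;> simp [questions]

theorem nodup_questions : (questions G).Nodup := by
  rw [questions, List.nodup_flatMap]
  refine ⟨fun k _ => by simp, ?_⟩
  refine (List.nodup_finRange G.m).pairwise_of_forall_ne fun k _ k' _ h => ?_
  simp [Function.onFun, List.disjoint_left, h]

theorem length_questions : (questions G).length = 2 * G.m := by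
  have h := List.toFinset_card_of_nodup (nodup_questions G)
  have h2 : (questions G).toFinset = Finset.univ := by
    ext q
    simp [mem_questions]
  rw [h2, Finset.card_univ] at h
  rw [← h]
  simp [mul_comm]

variable {G}

/-- The list of the answers of two deterministic provers to all challenges. -/
def tableAnswers (f : Table G × Table G) : List Answer :=
  (questions G).map f.1 ++ (questions G).map f.2

theorem map_questions_injective :
    Function.Injective fun f : Table G => (questions G).map f := fun _ _ h =>
  funext fun q => List.map_inj_left.1 h q (mem_questions G q)

theorem tableAnswers_injective : Function.Injective (tableAnswers (G := G)) := by
  intro f g h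
  obtain ⟨h1, h2⟩ := List.append_inj h (by simp)
  exact Prod.ext (map_questions_injective h1) (map_questions_injective h2)

theorem exists_map_questions {l : List Answer} (hl : l.length = (questions G).length) :
    ∃ f : Table G, (questions G).map f = l := by
  -- The default `0` is never read: every challenge occurs in the list, so its index is in range.
  refine ⟨fun q => l.getD ((questions G).idxOf q) 0, List.ext_getElem (by simp [hl]) ?_⟩
  intro i h1 h2
  rw [List.length_map] at h1
  simp [(nodup_questions G).idxOf_getElem i h1, h2]

theorem exists_tableAnswers {l : List Answer}
    (hl : l.length = (questions G).length + (questions G).length) :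
    ∃ f : Table G × Table G, tableAnswers f = l := by
  obtain ⟨f, hf⟩ := exists_map_questions (G := G) (l := l.take (questions G).length) (by simp [hl])
  obtain ⟨g, hg⟩ := exists_map_questions (G := G) (l := l.drop (questions G).length) (by simp [hl])
  exact ⟨(f, g), by rw [tableAnswers, hf, hg, List.take_append_drop]⟩

/-- The calls of the recording extractor: all challenges to the first prover, then to the second. -/
def recordCalls (G : GraphInstance) : List (Fin 3 × Question G) :=
  (questions G).map (Prod.mk 0) ++ (questions G).map (Prod.mk 1)

theorem recordingExtractor_calls (K : ClassicalExtractor) (G : GraphInstance) :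
    (recordingExtractor K).record.calls G = recordCalls G := by
  simp [recordingExtractor, RecordProgram.calls, RecordProgram.callsAt, sweep, recordCalls,
    questions, List.map_flatMap]

theorem length_recordCalls :
    (recordCalls G).length = (questions G).length + (questions G).length := by
  simp [recordCalls]

theorem list_sum_map_le {β : Type*} [Fintype β] {l : List β} (hl : l.Nodup)
    {t : β → ℝ} (ht : ∀ b, 0 ≤ t b) : (l.map t).sum ≤ ∑ b, t b := by
  classical
  rw [← List.sum_toFinset t hl]
  exact Finset.sum_le_univ_sum_of_nonneg ht

section Pullback

variable {J α κ : Type*} [Fintype J] [DecidableEq J] [Fintype α] {A : κ → α → Matrix J J ℂ}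

-- If the observable depends on two outcomes only, each of the three other blocks pulls back
-- something that ignores the outcomes of that block.
set_option linter.unusedSectionVars false in
theorem pullback_two_entries (L L' L'' : List κ) (c c' : κ)
    {X : List α → Matrix J J ℂ} {Y : α → α → Matrix J J ℂ}
    (h : ∀ l a l' a' l'', l.length = L.length → l'.length = L'.length → l''.length = L''.length →
      X (l ++ a :: (l' ++ a' :: l'')) = Y a a') :
    pullback A (L ++ c :: (L' ++ c' :: L'')) X =
      pullback A L fun _ => ∑ a, A c a * pullback A L' (fun _ =>
        ∑ a', A c' a' * pullback A L'' (fun _ => Y a a') * A c' a') * A c a := by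
  rw [pullback_append]
  refine pullback_congr fun l hl => ?_
  rw [pullback]
  refine Finset.sum_congr rfl fun a _ => ?_
  rw [pullback_append]
  congr 2
  refine pullback_congr fun l' hl' => ?_
  rw [pullback]
  refine Finset.sum_congr rfl fun a' _ => ?_
  congr 2
  exact pullback_congr fun l'' hl'' => h l a l' a' l'' hl hl' hl''

end Pullback

/-! ### The recorded tables as a classical strategy -/

namespace QuantumStrategy

variable (S : QuantumStrategy G)

open Classical in
/-- The probability that the recording extractor obtains the tables `f`. -/
def tableWeight (f : Table G × Table G) : ℝ :=
  expect S.ρ (pullback S.callOp (recordCalls G) fun l =>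
    (if l = tableAnswers f then (1 : ℝ) else 0) • 1)

theorem tableWeight_nonneg (f : Table G × Table G) : 0 ≤ S.tableWeight f := by
  refine expect_nonneg S.posSemidef (pullback_posSemidef S.callOp_isSharp _ fun l => ?_)
  exact posSemidef_real_smul Matrix.PosSemidef.one (by split_ifs <;> simp)

/-- Outcome lists of full length correspond bijectively to pairs of tables, so any function of the
record expands in their indicators. -/
theorem expect_pullback_recordCalls (out : List Answer → ℝ) :
    expect S.ρ (pullback S.callOp (recordCalls G) fun l => out l • 1) =
      ∑ f, S.tableWeight f * out (tableAnswers f) := by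
  classical
  have h : pullback S.callOp (recordCalls G) (fun l => out l • 1) =
      pullback S.callOp (recordCalls G) fun l =>
        ∑ f : Table G × Table G, out (tableAnswers f) • (if l = tableAnswers f then (1 : ℝ) else 0) •
          (1 : Matrix S.Joint S.Joint ℂ) := by
    refine pullback_congr fun l hl => ?_
    obtain ⟨f, rfl⟩ := exists_tableAnswers (hl.trans length_recordCalls)
    simp [tableAnswers_injective.eq_iff]
  rw [h, pullback_sum, expect_sum]
  refine Finset.sum_congr rfl fun f _ => ?_
  rw [pullback_smul, expect_smul, mul_comm, tableWeight]

theorem sum_tableWeight : ∑ f, S.tableWeight f = 1 := by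
  have h := S.expect_pullback_recordCalls fun _ => 1
  simp only [mul_one, one_smul] at h
  rw [← h, pullback_const S.callOp_isSharp fun _ _ _ => Commute.one_left _, expect_one]

/-- The classical strategy that answers by the tables which the recording extractor obtains. -/
def recordedStrategy : ClassicalStrategy G :=
  PMF.ofFintype (fun f => ENNReal.ofReal (S.tableWeight f)) (by
    rw [← ENNReal.ofReal_sum_of_nonneg fun f _ => S.tableWeight_nonneg f, S.sum_tableWeight,
      ENNReal.ofReal_one])

theorem toReal_recordedStrategy (f : Table G × Table G) :
    (S.recordedStrategy f).toReal = S.tableWeight f := by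
  rw [recordedStrategy, PMF.ofFintype_apply, ENNReal.toReal_ofReal (S.tableWeight_nonneg f)]

theorem extractProb_recordingExtractor (K : ClassicalExtractor) :
    (recordingExtractor K).extractProb G S = K.extractProb G S.recordedStrategy := by
  rw [QuantumExtractor.extractProb, recordingExtractor_calls, runCalls_eq]
  simp only [List.nil_append, expect_pullback_recordCalls, ClassicalExtractor.extractProb,
    toReal_recordedStrategy]
  rfl

/-! ### The disturbance caused by recording -/

/-- The bound on the disturbance by the measurement of prover `i` on the challenge `q`. -/
def disturbance (s : ℝ) (i : Fin 3) (q : Question G) : ℝ :=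
  s + (1 + 1 / s) * (2 * (1 - S.agreeProb i q))

/-- Lets a sum over the challenges already asked be enlarged to all challenges. -/
theorem disturbance_nonneg {s : ℝ} (hs : 0 < s) {i : Fin 3} (hi : i ≠ 2) (q : Question G) :
    0 ≤ S.disturbance s i q := by
  have := sub_nonneg.2 (S.agreeProb_le_one hi q)
  rw [disturbance]
  positivity

open Classical in
/-- The effect that the first two provers pass the two-prover check on `q, q'`. -/
def passEffect (q q' : Question G) : Matrix S.Joint S.Joint ℂ :=
  ∑ a, ∑ a', (if Accepts2 G q q' a a' then (1 : ℝ) else 0) •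
    (S.callOp (0, q) a * S.callOp (1, q') a')

theorem expect_passEffect (q q' : Question G) :
    expect S.ρ (S.passEffect q q') = S.passProb q q' := by
  simp only [passEffect, passProb, expect_sum, expect_smul]

theorem passEffect_posSemidef (q q' : Question G) : (S.passEffect q q').PosSemidef :=
  Matrix.posSemidef_sum _ fun a _ => Matrix.posSemidef_sum _ fun a' _ =>
    posSemidef_real_smul (S.posSemidef_callOp_mul (c := (0, q)) (c' := (1, q')) (by simp) a a')
      (by split_ifs <;> simp)

theorem one_sub_passEffect_posSemidef (q q' : Question G) :
    (1 - S.passEffect q q').PosSemidef := by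
  classical
  have h : 1 - S.passEffect q q' = ∑ a, ∑ a',
      (1 - if Accepts2 G q q' a a' then (1 : ℝ) else 0) •
        (S.callOp (0, q) a * S.callOp (1, q') a') := by
    simp only [sub_smul, one_smul, Finset.sum_sub_distrib, ← Matrix.mul_sum,
      (S.callOp_isSharp _).sum_eq_one, Matrix.mul_one, passEffect]
  rw [h]
  exact Matrix.posSemidef_sum _ fun a _ => Matrix.posSemidef_sum _ fun a' _ =>
    posSemidef_real_smul (S.posSemidef_callOp_mul (c := (0, q)) (c' := (1, q')) (by simp) a a')
      (by split_ifs <;> simp)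

theorem passEffect_commute (q q' q'' : Question G) (a'' : Answer) :
    Commute (S.passEffect q q') (S.callOp (2, q'') a'') := by
  refine Commute.sum_left _ _ _ fun a _ => Commute.sum_left _ _ _ fun a' _ => ?_
  exact ((S.callOp_commute (c := (0, q)) (by simp) a a'').mul_left
    (S.callOp_commute (c := (1, q')) (by simp) a' a'')).smul_left _

open Classical in
/-- The recorded answers to `q, q'` pass the two-prover check almost as often as fresh answers. -/
theorem sum_tableWeight_accepts_ge {s : ℝ} (hs : 0 < s) (q q' : Question G) :
    S.passProb q q' - ((∑ r, S.disturbance s 0 r) + ∑ r, S.disturbance s 1 r) ≤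
      ∑ f, S.tableWeight f * (if Accepts2 G q q' (f.1 q) (f.2 q') then 1 else 0) := by
  -- Isolate the calls that ask prover 1 for `q` and prover 2 for `q'`. `L₁` and `L₃` are the
  -- earlier challenges to the same prover, `L₂` and `L₄` the later ones.
  obtain ⟨L₁, L₂, h₁⟩ := List.append_of_mem (mem_questions G q)
  obtain ⟨L₃, L₄, h₂⟩ := List.append_of_mem (mem_questions G q')
  have hcalls : recordCalls G = L₁.map (Prod.mk 0) ++ (0, q) ::
      ((L₂.map (Prod.mk 0) ++ L₃.map (Prod.mk 1)) ++ (1, q') :: L₄.map (Prod.mk 1)) := by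
    rw [recordCalls]
    nth_rw 1 [h₁]
    rw [h₂]
    simp
  let g : Answer → Answer → ℝ := fun a a' => if Accepts2 G q q' a a' then 1 else 0
  let out : List Answer → ℝ := fun l =>
    ∑ f : Table G × Table G, if l = tableAnswers f then g (f.1 q) (f.2 q') else 0
  have hout : ∀ f, out (tableAnswers f) = g (f.1 q) (f.2 q') := fun f => by
    simp [out, tableAnswers_injective.eq_iff]
  have hlen₁ : (questions G).length = L₁.length + (L₂.length + 1) := by
    rw [h₁]; simp
  have hlen₂ : (questions G).length = L₃.length + (L₄.length + 1) := by
    rw [h₂]; simp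
  have hentries : ∀ l a l' a' l'', l.length = (L₁.map (Prod.mk (0 : Fin 3))).length →
      l'.length = (L₂.map (Prod.mk (0 : Fin 3)) ++ L₃.map (Prod.mk 1)).length →
      l''.length = (L₄.map (Prod.mk (1 : Fin 3))).length →
      out (l ++ a :: (l' ++ a' :: l'')) • (1 : Matrix S.Joint S.Joint ℂ) = g a a' • 1 := by
    intro l a l' a' l'' hl hl' hl''
    simp only [List.length_map, List.length_append] at hl hl' hl''
    obtain ⟨f, hf⟩ := exists_tableAnswers (G := G) (l := l ++ a :: (l' ++ a' :: l'')) (by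
      simp only [List.length_append, List.length_cons]
      omega)
    rw [← hf, hout]
    have hf' : L₁.map f.1 ++ f.1 q :: ((L₂.map f.1 ++ L₃.map f.2) ++ f.2 q' :: L₄.map f.2) =
        l ++ a :: (l' ++ a' :: l'') := by
      rw [← hf, tableAnswers]
      nth_rw 1 [h₁]
      rw [h₂]
      simp
    obtain ⟨-, e1⟩ := List.append_inj hf' (by simp [hl])
    obtain ⟨e2, e3⟩ := List.cons.inj e1
    obtain ⟨-, e4⟩ := List.append_inj e3 (by simp [hl'])
    rw [e2, (List.cons.inj e4).1]
  have hsum := S.expect_pullback_recordCalls out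
  simp only [hout] at hsum
  change _ ≤ ∑ f, S.tableWeight f * g (f.1 q) (f.2 q')
  rw [← hsum, hcalls, pullback_two_entries _ _ _ _ _ hentries]
  have hcomm : ∀ L : List (Question G), ∀ c ∈ L.map (Prod.mk (1 : Fin 3)), ∀ b a,
      Commute (S.callOp (0, q) a) (S.callOp c b) := by
    intro L c hc b a
    obtain ⟨r, -, rfl⟩ := List.mem_map.1 hc
    exact S.callOp_commute (by simp) a b
  have hinner : ∀ a, (∑ a', S.callOp (1, q') a' *
      pullback S.callOp (L₄.map (Prod.mk 1)) (fun _ => g a a' • 1) * S.callOp (1, q') a') =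
      ∑ a', g a a' • S.callOp (1, q') a' := by
    intro a
    refine Finset.sum_congr rfl fun a' _ => ?_
    rw [pullback_const S.callOp_isSharp fun _ _ _ => (Commute.one_left _).smul_left _]
    simp [(S.callOp_isSharp _).idem]
  have hzero : ∀ a, ∀ r : Question G, ∀ b, Commute (S.callOp (0, r) b)
      (pullback S.callOp (L₃.map (Prod.mk 1)) fun _ => ∑ a', g a a' • S.callOp (1, q') a') := by
    intro a r b
    refine pullback_commute (fun _ => Commute.sum_right _ _ _ fun a' _ =>
      (S.callOp_commute (by simp) b a').smul_right _) fun c hc b' => ?_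
    obtain ⟨r', -, rfl⟩ := List.mem_map.1 hc
    exact S.callOp_commute (by simp) b b'
  -- The later measurements drop out: those of `L₄` act on a constant, those of `L₂` on a register
  -- that the rest of the effect does not touch. The two outer projectors of prover 1 then merge and
  -- move inside the pullback along `L₃`.
  have hmid : (∑ a, S.callOp (0, q) a *
      pullback S.callOp (L₂.map (Prod.mk 0) ++ L₃.map (Prod.mk 1)) (fun _ =>
        ∑ a', S.callOp (1, q') a' *
          pullback S.callOp (L₄.map (Prod.mk 1)) (fun _ => g a a' • 1) * S.callOp (1, q') a') *
        S.callOp (0, q) a) =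
      pullback S.callOp (L₃.map (Prod.mk 1)) fun _ => S.passEffect q q' := by
    have hpass : S.passEffect q q' =
        ∑ a, S.callOp (0, q) a * ∑ a', g a a' • S.callOp (1, q') a' := by
      simp only [passEffect, Finset.mul_sum, Matrix.mul_smul, g]
    rw [hpass, pullback_sum]
    refine Finset.sum_congr rfl fun a _ => ?_
    rw [hinner, pullback_append, pullback_const S.callOp_isSharp, pullback_mul_left, Matrix.mul_assoc,
      ← (hzero a q a).eq, ← Matrix.mul_assoc, (S.callOp_isSharp _).idem]
    · exact fun c hc b => hcomm _ c hc b a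
    · intro c hc b
      obtain ⟨r, -, rfl⟩ := List.mem_map.1 hc
      exact (hzero a r b).symm
  rw [hmid, ← pullback_append (A := S.callOp) _ _ fun _ => S.passEffect q q',
    ← S.expect_passEffect]
  -- The predictor `R` is the third prover, asked the same challenge as the prover being recorded.
  refine le_trans (sub_le_sub_left ?_ _) (expect_pullback_ge S.callOp_isSharp S.posSemidef
    S.expect_one (R := fun c => S.callOp (2, c.2)) (fun c => S.callOp_isSharp _) ?_
    (S.passEffect_posSemidef q q') (S.one_sub_passEffect_posSemidef q q')
    (fun c a => S.passEffect_commute q q' c.2 a) hs)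
  · have hn₁ : L₁.Nodup := by
      have := nodup_questions G
      rw [h₁] at this
      exact this.of_append_left
    have hn₃ : L₃.Nodup := by
      have := nodup_questions G
      rw [h₂] at this
      exact this.of_append_left
    rw [List.map_append, List.sum_append, List.map_map, List.map_map]
    exact add_le_add (list_sum_map_le hn₁ (S.disturbance_nonneg hs (by decide)))
      (list_sum_map_le hn₃ (S.disturbance_nonneg hs (by decide)))
  · intro c hc c' a a'
    refine S.callOp_commute ?_ a a'
    rcases List.mem_append.1 hc with hc | hc <;> obtain ⟨r, -, rfl⟩ := List.mem_map.1 hc <;> simp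

/-! ### Averaging over the challenges of the verifier -/

theorem acceptProb_eq : S.acceptProb = ∑ q, ∑ q', challengeProb G q q' *
    (1 / 2 * S.acceptProbAt q q' q + 1 / 2 * S.acceptProbAt q q' q') := by
  rw [acceptProb]
  exact Finset.sum_congr rfl fun q _ => Finset.sum_congr rfl fun q' _ =>
    sum_challengeProb3 G q q' (S.acceptProbAt q q')

theorem acceptProb_le_sum_passProb :
    S.acceptProb ≤ ∑ q, ∑ q', challengeProb G q q' * S.passProb q q' := by
  rw [acceptProb_eq]
  refine Finset.sum_le_sum fun q _ => Finset.sum_le_sum fun q' _ =>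
    mul_le_mul_of_nonneg_left ?_ (challengeProb_nonneg G q q')
  linarith [S.acceptProbAt_le_passProb q q' q, S.acceptProbAt_le_passProb q q' q']

/-- The third challenge copies each of the first two with probability one half, and both of these
are uniform over the `2|H|` challenges. -/
theorem acceptProb_le_sum_agreeProb :
    S.acceptProb ≤ 1 / (4 * G.m) * ∑ q, (S.agreeProb 0 q + S.agreeProb 1 q) := by
  have h : S.acceptProb ≤ ∑ q, ∑ q', challengeProb G q q' *
      (1 / 2 * S.agreeProb 0 q + 1 / 2 * S.agreeProb 1 q') := by
    rw [acceptProb_eq]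
    refine Finset.sum_le_sum fun q _ => Finset.sum_le_sum fun q' _ =>
      mul_le_mul_of_nonneg_left ?_ (challengeProb_nonneg G q q')
    linarith [S.acceptProbAt_le_agreeProb_zero q q', S.acceptProbAt_le_agreeProb_one q q']
  refine h.trans_eq ?_
  simp only [mul_add, Finset.sum_add_distrib]
  rw [Finset.sum_comm (f := fun q q' => challengeProb G q q' * (1 / 2 * S.agreeProb 1 q'))]
  simp only [← Finset.sum_mul, sum_challengeProb_right, sum_challengeProb_left, ← Finset.mul_sum]
  ring

/-- There are `4|H|` summands, and by the averaged agreement bound their disagreements total at most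
`4|H|(1 - p_acc)`. -/
theorem sum_disturbance_le {s : ℝ} (hs : 0 < s) :
    (∑ r, S.disturbance s 0 r) + ∑ r, S.disturbance s 1 r ≤
      4 * G.m * s + (1 + 1 / s) * (8 * G.m * (1 - S.acceptProb)) := by
  have hm : (0 : ℝ) < G.m := by exact_mod_cast G.pos
  have h := S.acceptProb_le_sum_agreeProb
  rw [one_div_mul_eq_div, le_div_iff₀ (by positivity), Finset.sum_add_distrib] at h
  simp only [disturbance, Finset.sum_add_distrib, ← Finset.mul_sum, Finset.sum_sub_distrib,
    Finset.sum_const, Finset.card_univ, Fintype.card_prod, Fintype.card_fin,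
    Fintype.card_bool, nsmul_eq_mul]
  push_cast
  have h' := mul_le_mul_of_nonneg_left h (by positivity : 0 ≤ 2 * (1 + 1 / s))
  linarith

theorem classicalAcceptProb_recordedStrategy_ge {s : ℝ} (hs : 0 < s) :
    S.acceptProb - (4 * G.m * s + (1 + 1 / s) * (8 * G.m * (1 - S.acceptProb))) ≤
      classicalAcceptProb G S.recordedStrategy := by
  classical
  have e : classicalAcceptProb G S.recordedStrategy = ∑ q, ∑ q', challengeProb G q q' *
      ∑ f, S.tableWeight f * (if Accepts2 G q q' (f.1 q) (f.2 q') then 1 else 0) := by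
    simp only [classicalAcceptProb, toReal_recordedStrategy, detAccept2, Finset.mul_sum]
    rw [Finset.sum_comm]
    refine Finset.sum_congr rfl fun q _ => ?_
    rw [Finset.sum_comm]
    refine Finset.sum_congr rfl fun q' _ => Finset.sum_congr rfl fun f _ => ?_
    ring_nf
  -- The loss is the same for every pair of challenges, so averaging leaves it unchanged.
  set T := (∑ r, S.disturbance s 0 r) + ∑ r, S.disturbance s 1 r with hT
  have h : ∑ q, ∑ q', challengeProb G q q' * (S.passProb q q' - T) ≤
      classicalAcceptProb G S.recordedStrategy := by
    rw [e]
    exact Finset.sum_le_sum fun q _ => Finset.sum_le_sum fun q' _ =>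
      mul_le_mul_of_nonneg_left (S.sum_tableWeight_accepts_ge hs q q') (challengeProb_nonneg G q q')
  simp only [mul_sub, Finset.sum_sub_distrib, ← Finset.sum_mul, sum_challengeProb, one_mul] at h
  linarith [S.acceptProb_le_sum_passProb, S.sum_disturbance_le hs]

end QuantumStrategy

theorem m_le_size (G : GraphInstance) : G.m ≤ G.size := by
  simp only [GraphInstance.size, GraphInstance.encode, encodeUnary, List.length_append,
    List.length_replicate]
  omega

end ThreeCol

end

/-! ### Choice of parameters and conclusion -/

theorem mainTheorem5 (𝒢 : Set ThreeCol.GraphInstance) (K : ThreeCol.ClassicalExtractor)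
    (hK : ThreeCol.IsClassicalExtractor 𝒢 K ThreeCol.classicalKnowledgeError)
    (δ : ThreeCol.GraphInstance → ℝ)
    (hδ : ∀ G ∈ 𝒢, δ G ≥ 1 / (3 * (G.m : ℝ)) - (1 / (7 * (G.m : ℝ))) ^ 4) :
    ThreeCol.IsQuantumProofOfKnowledge 𝒢 (ThreeCol.recordingExtractor K)
      (fun G => ThreeCol.classicalKnowledgeError G + δ G) := by
  -- The factor `8`: two provers, `2|H|` challenges each, and two oracle gates per call.
  refine ⟨fun G _ c hc => ThreeCol.honestAcceptProb3_eq_one hc, ⟨⟨8 * Polynomial.X, fun G => ?_⟩,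
    hK.polyTime⟩, ?_⟩
  · rw [ThreeCol.QuantumExtractor.oracleGates, ThreeCol.recordingExtractor_calls,
      ThreeCol.length_recordCalls, ThreeCol.length_questions]
    simp only [Polynomial.eval_mul, Polynomial.eval_X, Polynomial.eval_ofNat]
    have := ThreeCol.m_le_size G
    omega
  obtain ⟨d, hd, p, hp, hpoly, hval⟩ := hK.validity
  refine ⟨d, hd, p, hp, hpoly, fun l η G hG hsize S hacc => ?_⟩
  have hm : (1 : ℝ) ≤ G.m := by exact_mod_cast G.pos
  have hgain : S.acceptProb - (ThreeCol.classicalKnowledgeError G + δ G) ≤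
      ThreeCol.classicalAcceptProb G S.recordedStrategy - ThreeCol.classicalKnowledgeError G := by
    -- The order `|H|⁻²` balances `|H|s` against `|H|(1 - p_acc)/s` when `1 - p_acc` is of order
    -- `|H|⁻⁴`. With `x = 1/|H|` the loss is at most `2x/15 + (8x³ + 240x)/2401`, which is below
    -- `x/3 - x⁴/2401 ≤ δ G` since `x ≤ 1`.
    have hs : (0 : ℝ) < 1 / (30 * (G.m : ℝ) ^ 2) := by positivity
    have h := S.classicalAcceptProb_recordedStrategy_ge hs
    have hδG := hδ G hG
    simp only [ThreeCol.classicalKnowledgeError] at hacc ⊢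
    set x : ℝ := (G.m : ℝ)⁻¹ with hx
    have hx0 : 0 < x := by positivity
    have hx1 : x ≤ 1 := inv_le_one_of_one_le₀ hm
    have e1 : 1 / (3 * (G.m : ℝ)) = x / 3 := by rw [hx]; field_simp
    have e2 : (1 / (7 * (G.m : ℝ))) ^ 4 = x ^ 4 / 2401 := by rw [hx]; field_simp; norm_num
    have e3 : 4 * (G.m : ℝ) * (1 / (30 * (G.m : ℝ) ^ 2)) = 2 * x / 15 := by
      rw [hx]; field_simp; norm_num
    rw [e1] at hacc hδG ⊢
    rw [e2] at hδG
    rw [e3, one_div_one_div] at h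
    -- The `x/3` in the classical knowledge error cancels against the lower bound on `δ G`.
    have hε : 1 - S.acceptProb ≤ x ^ 4 / 2401 := by linarith
    have hc : (0 : ℝ) ≤ (1 + 30 * (G.m : ℝ) ^ 2) * (8 * G.m) := by positivity
    have hloss := mul_le_mul_of_nonneg_left hε hc
    have e4 : (1 + 30 * (G.m : ℝ) ^ 2) * (8 * G.m) * (x ^ 4 / 2401) =
        (8 * x ^ 3 + 240 * x) / 2401 := by
      rw [hx]; field_simp; ring
    have hx3 : x ^ 3 ≤ x := pow_le_of_le_one hx0.le hx1 (by norm_num)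
    have hx4 : x ^ 4 ≤ x := pow_le_of_le_one hx0.le hx1 (by norm_num)
    linarith
  have hpos : 0 < S.acceptProb - (ThreeCol.classicalKnowledgeError G + δ G) := sub_pos.2 hacc
  have h := hval l η G hG hsize S.recordedStrategy (by linarith)
  rw [ge_iff_le, S.extractProb_recordingExtractor]
  refine le_trans (mul_le_mul_of_nonneg_left ?_ (one_div_pos.2 (hp η)).le) h
  exact Real.rpow_le_rpow hpos.le hgain hd.le
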